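/- Let $X$ be a set and let $\mathbf d\colon X\times X\to[0,\infty]$ be a distance, i.e. $x\mathbf dy\le x\mathbf dz+z\mathbf dy$ for all $x,y,z\in X$ (neither symmetry nor $x\mathbf dx=0$ is assumed). **Notation.** In $[0,\infty]$ write $(a-b)_+$ for the truncated difference, with $(\infty-\infty)_+=0$, and $\inf\emptyset=\infty$, $\sup\emptyset=0$. * For a distance $\mathbf e$ on a set $Z$, $x\le^{\mathbf e}y$ means $x\mathbf ey=0$, and the lower hemimetric is $z\underline{\mathbf e}y=\sup_{x\in Z}(x\mathbf ey-x\mathbf ez)_+$. The topology $\mathbf e^\bullet$ is generated by the upper balls $\{x: c\mathbf ex<r\}$, and the Smyth topology $\mathbf e^\bullet_\circ$ by these balls together with the lower holes $\{x: c\mathbf ex>r\}$. The strict order is defined by: $x<^{\mathbf e}y$ iff $\{z: x\le^{\mathbf e}z\}$ is an $\underline{\mathbf e}^\bullet$-neighbourhood of $y$. * Nets are indexed by non-empty sets $\Lambda$ with a transitive (possibly non-reflexive) relation $\prec$ such that any $\gamma,\delta\in\Lambda$ have some $\lambda\in\Lambda$ with $\gamma,\delta\prec\lambda$; limits are taken along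 the tails $\{\delta:\gamma\prec\delta\}$. A net $(x_\lambda)$ is $\mathbf d$-Cauchy if $\lim_\gamma\sup_{\gamma\prec\delta}x_\gamma\mathbf dx_\delta=0$. $X$ is $\mathbf d^\bullet_\circ$-complete if every $\mathbf d$-Cauchy net in $X$ has a $\mathbf d^\bullet_\circ$-limit in $X$, and $\mathbf d^\bullet_\circ$-continuous if every point of $X$ is a $\mathbf d^\bullet_\circ$-limit of some $\mathbf d$-Cauchy net in $X$. * For a relation $<$ on a set $Z$, a subset $Y\subseteq Z$ is $<$-directed if every finite $F\subseteq Y$ (including $F=\emptyset$) has some $y\in Y$ with $f<y$ for all $f\in F$. A point $x\in Z$ is a $<$-maximum of $Y$ if $y<x$ for all $y\in Y$, and every $z<x$ satisfies $z<y$ for some $y\in Y$. $Z$ is $<$-$\max$-complete if every $<$-directed subset has a $<$-maximum, and $<$-$\max$-continuous if every point of $Z$ is a $<$-maximum of some $<$-directed subset. * The formal balls are $X_+=X\times[0,\infty)$ with $(x,r)\mathbf d_+(y,s)=(x\mathbf dy-r+s)_+$, and $\underline{\mathbf d}_+$ is obtained from $\underline{\mathbf d}$ in the same way. * $\mathbf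 0\circ\mathbf d=\mathbf 0$ means that $\inf_{z\in X}z\mathbf dy=0$ for every $y\in X$. **Theorem.** 1. If $\underline{\mathbf d_+}=\underline{\mathbf d}_+$, then $X$ is $\mathbf d^\bullet_\circ$-complete if and only if $X_+$ is $<^{\mathbf d_+}$-$\max$-complete. 2. (Without that hypothesis.) $X$ is $\mathbf d^\bullet_\circ$-continuous if and only if $X_+$ is $<^{\mathbf d_+}$-$\max$-continuous and $\mathbf 0\circ\mathbf d=\mathbf 0$. -/

import Mathlib

open scoped ENNReal NNReal

universe u v

namespace DistDom

section Basic

variable {X : Type u}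

/-- Composition of generalised relations: the infimum over `z` of `a x z + b z y`. -/
noncomputable def comp (a b : X → X → ℝ≥0∞) : X → X → ℝ≥0∞ :=
  fun x y => ⨅ z : X, a x z + b z y

/-- A distance is a function with values in `[0,∞]` satisfying the triangle inequality. -/
def IsDistance (d : X → X → ℝ≥0∞) : Prop :=
  d ≤ comp d d

/-- The classical relation of the pairs at distance zero. -/
def leRel (d : X → X → ℝ≥0∞) (x y : X) : Prop :=
  d x y = 0

open Classical in
/-- The characteristic function of a classical relation: `0` where it holds, `∞` elsewhere. -/
noncomputable def charFn (R : X → X → Prop) : X → X → ℝ≥0∞ :=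
  fun x y => if R x y then 0 else ∞

/-- The lower hemimetric, the supremum over `x` of `(d x y - d x z)₊`.
Subtraction in `[0,∞]` is truncated at `0`, with `∞ - ∞ = 0`. -/
noncomputable def lower (d : X → X → ℝ≥0∞) : X → X → ℝ≥0∞ :=
  fun z y => ⨆ x : X, (d x y - d x z)

/-- The Alexandroff topology, generated by the upper balls. -/
def alexandroff (d : X → X → ℝ≥0∞) : TopologicalSpace X :=
  TopologicalSpace.generateFrom {s | ∃ (c : X) (r : ℝ≥0∞), s = {x | d c x < r}}

/-- The lower topology, generated by the lower holes. -/
def lowerTop (d : X → X → ℝ≥0∞) : TopologicalSpace X :=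
  TopologicalSpace.generateFrom {s | ∃ (c : X) (r : ℝ≥0∞), s = {x | r < d c x}}

/-- The Smyth topology, generated by the upper balls and the lower holes
(the infimum in Mathlib's order on topologies is the coarsest common refinement). -/
def smyth (d : X → X → ℝ≥0∞) : TopologicalSpace X :=
  alexandroff d ⊓ lowerTop d

/-- The strict order of `d`: the set of `z` with `d x z = 0` is a neighbourhood of `y`
in the Alexandroff topology of the lower hemimetric. -/
def strict (d : X → X → ℝ≥0∞) (x y : X) : Prop :=
  {z | leRel d x z} ∈ @nhds X (alexandroff (lower d)) y

/-- `Y` is `d`-directed. -/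
def DirectedSet (d : X → X → ℝ≥0∞) (Y : Set X) : Prop :=
  ∀ F : Set X, F.Finite → F ⊆ Y → (⨅ y ∈ Y, ⨆ z ∈ F, d z y) = 0

/-- `x` is a `d`-maximum of `Y`. -/
def IsMaximum (d : X → X → ℝ≥0∞) (x : X) (Y : Set X) : Prop :=
  (∀ y ∈ Y, leRel d y x) ∧ ∀ z : X, (⨅ y ∈ Y, d z y) ≤ d z x

/-- The index sets of nets: nonempty, with a transitive (possibly non-reflexive) relation for
which any two elements have a common successor. -/
def IsNetOrder {Λ : Type v} (lt : Λ → Λ → Prop) : Prop :=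
  Nonempty Λ ∧ (∀ a b c, lt a b → lt b c → lt a c) ∧ ∀ a b, ∃ c, lt a c ∧ lt b c

/-- The filter of tails of an index set. -/
def tails {Λ : Type v} (lt : Λ → Λ → Prop) : Filter Λ :=
  ⨅ γ : Λ, Filter.principal {δ | lt γ δ}

/-- The net `x` is `d`-Cauchy: the supremum of `d (x γ) (x δ)` over `δ` beyond `γ` tends to `0`
along `γ`. -/
def CauchyNet (d : X → X → ℝ≥0∞) {Λ : Type v} (lt : Λ → Λ → Prop) (x : Λ → X) : Prop :=
  Filter.Tendsto (fun γ : Λ => ⨆ (δ : Λ) (_ : lt γ δ), d (x γ) (x δ)) (tails lt) (nhds 0)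

/-- Every `d`-Cauchy net has a limit in the topology `T`. -/
def TopComplete (d : X → X → ℝ≥0∞) (T : TopologicalSpace X) : Prop :=
  ∀ (Λ : Type u) (lt : Λ → Λ → Prop), IsNetOrder lt → ∀ x : Λ → X, CauchyNet d lt x →
    ∃ l : X, Filter.Tendsto x (tails lt) (@nhds X T l)

/-- Every point is a limit in the topology `T` of a `d`-Cauchy net. -/
def TopContinuous (d : X → X → ℝ≥0∞) (T : TopologicalSpace X) : Prop :=
  ∀ l : X, ∃ (Λ : Type u) (lt : Λ → Λ → Prop) (x : Λ → X),
    IsNetOrder lt ∧ CauchyNet d lt x ∧ Filter.Tendsto x (tails lt) (@nhds X T l)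

/-- Every `d`-directed set has a `d`-maximum. -/
def MaxComplete (d : X → X → ℝ≥0∞) : Prop :=
  ∀ Y : Set X, DirectedSet d Y → ∃ x : X, IsMaximum d x Y

/-- Every point is a `d`-maximum of some `d`-directed set. -/
def MaxContinuous (d : X → X → ℝ≥0∞) : Prop :=
  ∀ x : X, ∃ Y : Set X, DirectedSet d Y ∧ IsMaximum d x Y

/-- The distance `(d x y - r + s)₊` on formal balls. -/
noncomputable def plus (d : X → X → ℝ≥0∞) : X × ℝ≥0 → X × ℝ≥0 → ℝ≥0∞ :=
  fun p q => (d p.1 q.1 + (q.2 : ℝ≥0∞)) - (p.2 : ℝ≥0∞)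

end Basic

end DistDom

namespace DistDom

/-! ### Hemimetric neighbourhoods and the strict order on formal balls. -/

section Prelim

variable {X : Type u}

/-! By `strict_plus_iff`, `(x, r)` lies strictly below `(y, s)` exactly when `d x y + s < r`; by
`tendsto_smyth_iff`, a Smyth limit `l` of a net is a point with `d c x_γ → d c l` for all `c`. The
two notions then translate into each other.

From nets to balls: along a Cauchy net `d c x_γ` converges to some `f c`, with `f (x_γ)` eventually
arbitrarily small. The balls `(c, t)` with `f c + r < t` form a directed set
(`CauchyNet.exists_ball`).

From balls to nets: a directed set of balls, indexed by itself under the strict order, has a Cauchy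
net of centres, and its radii converge to their infimum (`cauchyNet_ballLt`). A limit of the centres
paired with this infimum is a maximum. Conversely, a maximum of radius `0` has its centre as limit
once that infimum is `0`, which `comp 0 d = 0` guarantees. -/

theorem IsDistance.triangle {d : X → X → ℝ≥0∞} (hd : IsDistance d) (x y z : X) :
    d x y ≤ d x z + d z y :=
  (hd x y).trans (iInf_le _ z)

theorem lower_self (d : X → X → ℝ≥0∞) (x : X) : lower d x x = 0 := by
  simp [lower]

theorem le_add_lower (d : X → X → ℝ≥0∞) (x y z : X) : d x y ≤ d x z + lower d z y := by
  rw [add_comm, ← tsub_le_iff_right]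
  exact le_iSup (fun x => d x y - d x z) x

theorem lower_triangle (d : X → X → ℝ≥0∞) (x y z : X) :
    lower d x y ≤ lower d x z + lower d z y := by
  refine iSup_le fun w => ?_
  rw [tsub_le_iff_right]
  calc d w y ≤ d w z + lower d z y := le_add_lower d w y z
    _ ≤ (d w x + lower d x z) + lower d z y := by gcongr; exact le_add_lower d w z x
    _ = lower d x z + lower d z y + d w x := by ring

/-- In the Alexandroff topology of a hemimetric, the balls around a point are a basis of its
neighbourhoods. -/
theorem mem_nhds_alexandroff {e : X → X → ℝ≥0∞} (h0 : ∀ x, e x x = 0)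
    (ht : ∀ x y z, e x y ≤ e x z + e z y) {y : X} {s : Set X} :
    s ∈ @nhds X (alexandroff e) y ↔ ∃ ε : ℝ≥0, 0 < ε ∧ ∀ z, e y z < ε → z ∈ s := by
  let _ : TopologicalSpace X := alexandroff e
  constructor
  · intro hs
    obtain ⟨t, hts, hopen, hyt⟩ := mem_nhds_iff.1 hs
    suffices h : ∃ ε : ℝ≥0, 0 < ε ∧ ∀ z, e y z < ε → z ∈ t by
      obtain ⟨ε, hε, h⟩ := h
      exact ⟨ε, hε, fun z hz => hts (h z hz)⟩
    clear hts
    have hopen' : TopologicalSpace.GenerateOpen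
        {s | ∃ (c : X) (r : ℝ≥0∞), s = {x | e c x < r}} t := hopen
    clear hopen
    induction hopen' with
    | basic s hs =>
      obtain ⟨c, r, rfl⟩ := hs
      obtain ⟨ε, hε, h⟩ := ENNReal.lt_iff_exists_add_pos_lt.1 (show e c y < r from hyt)
      refine ⟨ε, hε, fun z hz => ?_⟩
      calc e c z ≤ e c y + e y z := ht _ _ _
        _ ≤ e c y + ε := by gcongr
        _ < r := h
    | univ => exact ⟨1, one_pos, fun z _ => trivial⟩
    | inter s t _ _ ihs iht =>
      obtain ⟨ε, hε, h⟩ := ihs hyt.1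
      obtain ⟨δ, hδ, h'⟩ := iht hyt.2
      refine ⟨min ε δ, lt_min hε hδ, fun z hz => ⟨h z (hz.trans_le ?_), h' z (hz.trans_le ?_)⟩⟩
      · exact_mod_cast min_le_left _ _
      · exact_mod_cast min_le_right _ _
    | sUnion S _ ih =>
      obtain ⟨s, hsS, hys⟩ := hyt
      obtain ⟨ε, hε, h⟩ := ih s hsS hys
      exact ⟨ε, hε, fun z hz => ⟨s, hsS, h z hz⟩⟩
  · rintro ⟨ε, hε, h⟩
    refine Filter.mem_of_superset (IsOpen.mem_nhds (s := {z | e y z < ε}) ?_ ?_) h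
    · exact TopologicalSpace.GenerateOpen.basic _ ⟨y, ε, rfl⟩
    · simpa [h0] using hε

/-- The strict order on formal balls. -/
theorem strict_plus_iff (d : X → X → ℝ≥0∞) (p q : X × ℝ≥0) :
    strict (plus d) p q ↔ d p.1 q.1 + q.2 < p.2 := by
  unfold strict
  rw [mem_nhds_alexandroff (lower_self _) (lower_triangle _)]
  simp only [Set.mem_ofPred_eq, leRel, plus, tsub_eq_zero_iff_le]
  constructor
  · rintro ⟨ε, hε, h⟩
    -- Enlarging the radius of `q` by `ε / 2` stays within the neighbourhood, and this increment
    -- makes the inequality at `q` strict.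
    have hlow : lower (plus d) q (q.1, q.2 + ε / 2) < ε := by
      refine lt_of_le_of_lt (b := ((ε / 2 : ℝ≥0) : ℝ≥0∞)) (iSup_le fun w => ?_)
        (by exact_mod_cast NNReal.half_lt_self hε.ne')
      simp only [plus, tsub_le_iff_right]
      calc d w.1 q.1 + ((q.2 + ε / 2 : ℝ≥0) : ℝ≥0∞)
          = (d w.1 q.1 + q.2) + (ε / 2 : ℝ≥0) := by rw [ENNReal.coe_add, add_assoc]
        _ ≤ (d w.1 q.1 + q.2 - w.2 + w.2) + (ε / 2 : ℝ≥0) := add_le_add le_tsub_add le_rfl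
        _ = (ε / 2 : ℝ≥0) + (d w.1 q.1 + q.2 - w.2) + w.2 := by ring
    have hle := h _ hlow
    simp only [ENNReal.coe_add, ← add_assoc] at hle
    refine lt_of_lt_of_le (ENNReal.lt_add_right ?_ ?_) hle
    · exact ne_top_of_le_ne_top ENNReal.coe_ne_top (le_self_add.trans hle)
    · exact_mod_cast (half_pos hε).ne'
  · intro h
    obtain ⟨ε, hε, h'⟩ := ENNReal.lt_iff_exists_add_pos_lt.1 h
    refine ⟨ε, hε, fun z hz => ?_⟩
    -- From a ball of radius `0` the distance `plus d` involves no truncation.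
    have := le_add_lower (plus d) (p.1, 0) z q
    simp only [plus, ENNReal.coe_zero, tsub_zero] at this
    exact this.trans ((add_le_add_right hz.le _).trans h'.le)

open Classical in
-- `charFn` takes only the values `0` and `∞`, so an infimum below `1` yields a witness at which the
-- value is `0`.
theorem directedSet_charFn_iff (R : X → X → Prop) (Y : Set X) :
    DirectedSet (charFn R) Y ↔
      ∀ F : Set X, F.Finite → F ⊆ Y → ∃ y ∈ Y, ∀ z ∈ F, R z y := by
  refine forall₃_congr fun F _ _ => ?_
  constructor
  · intro h
    have h1 : (⨅ y ∈ Y, ⨆ z ∈ F, charFn R z y) < 1 := h ▸ one_pos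
    simp only [iInf_lt_iff] at h1
    obtain ⟨y, hy, hlt⟩ := h1
    refine ⟨y, hy, fun z hz => ?_⟩
    by_contra hR
    have : charFn R z y ≤ _ := le_iSup₂ (f := fun z (_ : z ∈ F) => charFn R z y) z hz
    simp only [charFn, if_neg hR] at this
    exact absurd (this.trans_lt hlt) (by simp)
  · rintro ⟨y, hy, h⟩
    refine le_antisymm ((iInf₂_le y hy).trans (iSup₂_le fun z hz => ?_)) bot_le
    simp [charFn, h z hz]

open Classical in
theorem isMaximum_charFn_iff (R : X → X → Prop) (x : X) (Y : Set X) :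
    IsMaximum (charFn R) x Y ↔ (∀ y ∈ Y, R y x) ∧ ∀ z, R z x → ∃ y ∈ Y, R z y := by
  refine and_congr (forall₂_congr fun y _ => ?_) (forall_congr' fun z => ?_)
  · simp [leRel, charFn]
  · constructor
    · intro h hz
      have h1 : (⨅ y ∈ Y, charFn R z y) < 1 := by
        refine h.trans_lt ?_
        simp [charFn, hz]
      simp only [iInf_lt_iff] at h1
      obtain ⟨y, hy, hlt⟩ := h1
      refine ⟨y, hy, ?_⟩
      by_contra hR
      simp [charFn, hR] at hlt
    · intro h
      by_cases hz : R z x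
      · obtain ⟨y, hy, hR⟩ := h hz
        exact (iInf₂_le y hy).trans (by simp [charFn, hR])
      · simp [charFn, hz]

end Prelim

/-! ### Cauchy nets and Smyth limits. -/

section Nets

variable {X : Type u} {Λ : Type v} {lt : Λ → Λ → Prop}

theorem mem_tails (hΛ : IsNetOrder lt) {s : Set Λ} :
    s ∈ tails lt ↔ ∃ γ, ∀ δ, lt γ δ → δ ∈ s := by
  obtain ⟨hne, htr, hdir⟩ := hΛ
  unfold tails
  rw [Filter.mem_iInf_of_directed]
  · rfl
  · intro a b
    obtain ⟨c, hac, hbc⟩ := hdir a b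
    refine ⟨c, ?_, ?_⟩ <;> simp only [ge_iff_le, Filter.le_principal_iff, Filter.mem_principal]
    · exact fun δ h => htr _ _ _ hac h
    · exact fun δ h => htr _ _ _ hbc h

theorem eventually_tails (hΛ : IsNetOrder lt) {P : Λ → Prop} :
    (∀ᶠ γ in tails lt, P γ) ↔ ∃ γ, ∀ δ, lt γ δ → P δ :=
  mem_tails hΛ

theorem eventually_tails_lt (hΛ : IsNetOrder lt) (γ : Λ) : ∀ᶠ δ in tails lt, lt γ δ :=
  (eventually_tails hΛ).2 ⟨γ, fun _ h => h⟩

theorem tails_neBot (hΛ : IsNetOrder lt) : (tails lt).NeBot := by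
  refine Filter.neBot_iff.2 fun h => ?_
  obtain ⟨γ, hγ⟩ := (mem_tails hΛ).1 (Filter.empty_mem_iff_bot.2 h)
  obtain ⟨c, hc, -⟩ := hΛ.2.2 γ γ
  exact hγ c hc

/-- Convergence in the Smyth topology is pointwise convergence of the distances to the net. -/
theorem tendsto_smyth_iff (d : X → X → ℝ≥0∞) {ι : Type v} {f : Filter ι} {x : ι → X} {l : X} :
    Filter.Tendsto x f (@nhds X (smyth d) l) ↔
      ∀ c, Filter.Tendsto (fun i => d c (x i)) f (nhds (d c l)) := by
  have h : @nhds X (smyth d) l = @nhds X (alexandroff d) l ⊓ @nhds X (lowerTop d) l :=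
    nhds_inf
  rw [h, Filter.tendsto_inf, alexandroff, lowerTop,
    TopologicalSpace.tendsto_nhds_generateFrom_iff, TopologicalSpace.tendsto_nhds_generateFrom_iff]
  simp only [tendsto_order]
  constructor
  · rintro ⟨h1, h2⟩ c
    exact ⟨fun r hr => h2 _ ⟨c, r, rfl⟩ hr, fun r hr => h1 _ ⟨c, r, rfl⟩ hr⟩
  · intro h
    constructor
    · rintro _ ⟨c, r, rfl⟩ hr
      exact (h c).2 r hr
    · rintro _ ⟨c, r, rfl⟩ hr
      exact (h c).1 r hr

theorem CauchyNet.eventually_le {d : X → X → ℝ≥0∞} {x : Λ → X} (hx : CauchyNet d lt x)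
    {ε : ℝ≥0∞} (hε : 0 < ε) :
    ∀ᶠ γ in tails lt, ∀ δ, lt γ δ → d (x γ) (x δ) ≤ ε :=
  (ENNReal.tendsto_nhds_zero.1 hx ε hε).mono fun _ h _ hδ => (le_iSup₂ _ hδ).trans h

/-- The distances to a Cauchy net converge. -/
theorem CauchyNet.exists_tendsto {d : X → X → ℝ≥0∞} (hd : IsDistance d) (hΛ : IsNetOrder lt)
    {x : Λ → X} (hx : CauchyNet d lt x) (c : X) :
    ∃ a, Filter.Tendsto (fun γ => d c (x γ)) (tails lt) (nhds a) := by
  -- The limit is the upper limit: a small value at a late `γ` would, by the triangle inequality,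
  -- keep all later values small.
  refine ⟨⨅ γ, ⨆ (δ : Λ) (_ : lt γ δ), d c (x δ), tendsto_order.2 ⟨fun r hr => ?_, fun r hr => ?_⟩⟩
  · obtain ⟨ε, hε, h⟩ := ENNReal.lt_iff_exists_add_pos_lt.1 hr
    refine (hx.eventually_le (ENNReal.coe_pos.2 hε)).mono fun γ hγ => ?_
    by_contra! hle
    refine h.not_ge ((iInf_le _ γ).trans (iSup₂_le fun δ hδ => ?_))
    exact (hd.triangle _ _ (x γ)).trans (add_le_add hle (hγ δ hδ))
  · obtain ⟨γ, hγ⟩ := iInf_lt_iff.1 hr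
    exact (eventually_tails hΛ).2 ⟨γ, fun δ hδ =>
      (le_iSup₂ (f := fun δ (_ : lt γ δ) => d c (x δ)) δ hδ).trans_lt hγ⟩

/-- The formal balls lying strictly below the limit of a Cauchy net are directed. -/
theorem CauchyNet.exists_ball {d : X → X → ℝ≥0∞} (hΛ : IsNetOrder lt)
    {x : Λ → X} (hx : CauchyNet d lt x) {f : X → ℝ≥0∞}
    (hf : ∀ c, Filter.Tendsto (fun γ => d c (x γ)) (tails lt) (nhds (f c))) (r : ℝ≥0)
    {F : Set (X × ℝ≥0)} (hF : F.Finite) (hlt : ∀ p ∈ F, f p.1 + r < p.2) :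
    ∃ q : X × ℝ≥0, f q.1 + r < q.2 ∧ ∀ p ∈ F, d p.1 q.1 + q.2 < p.2 := by
  have := tails_neBot hΛ
  have hη : ∀ᶠ η : ℝ≥0 in nhdsWithin 0 (Set.Ioi 0), ∀ p ∈ F, f p.1 + r + η < p.2 := by
    refine (Filter.eventually_all_finite hF).2 fun p hp => ?_
    obtain ⟨ε, hε, h⟩ := ENNReal.lt_iff_exists_add_pos_lt.1 (hlt p hp)
    filter_upwards [Ioo_mem_nhdsGT hε] with η hη
    refine lt_of_le_of_lt ?_ h
    gcongr
    exact hη.2.le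
  obtain ⟨η, hη, hη0⟩ := (hη.and self_mem_nhdsWithin).exists
  -- One third of the slack pays for approximating `f p.1` by `d p.1 (x γ)`; the other two go into
  -- the radius `ε + ε + r`, which must exceed `f (x γ) + r ≤ ε + r`.
  obtain ⟨ε, hε, rfl⟩ : ∃ ε : ℝ≥0, 0 < ε ∧ η = ε + ε + ε :=
    ⟨η / 3, div_pos hη0 three_pos, (add_thirds η).symm⟩
  have hε' : (0 : ℝ≥0∞) < ε := ENNReal.coe_pos.2 hε
  have h1 : ∀ᶠ γ in tails lt, ∀ p ∈ F, d p.1 (x γ) < f p.1 + ε := by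
    refine (Filter.eventually_all_finite hF).2 fun p hp => (hf p.1).eventually_lt_const ?_
    refine ENNReal.lt_add_right ?_ hε'.ne'
    exact ne_top_of_le_ne_top ENNReal.coe_ne_top (le_self_add.trans (hlt p hp).le)
  obtain ⟨γ, hγ1, hγ2⟩ := (h1.and (hx.eventually_le hε')).exists
  have hfγ : f (x γ) ≤ ε :=
    le_of_tendsto (hf (x γ)) ((eventually_tails_lt hΛ γ).mono hγ2)
  refine ⟨(x γ, ε + ε + r), ?_, fun p hp => ?_⟩
  · have : (ε : ℝ≥0∞) + r < ε + ε + r := by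
      exact_mod_cast add_lt_add_left (lt_add_of_pos_right ε hε) r
    simpa using (add_le_add_left hfγ (r : ℝ≥0∞)).trans_lt this
  · refine lt_of_le_of_lt ?_ (hη p hp)
    calc d p.1 (x γ) + ((ε + ε + r : ℝ≥0) : ℝ≥0∞)
        ≤ (f p.1 + ε) + ((ε + ε + r : ℝ≥0) : ℝ≥0∞) := by gcongr; exact (hγ1 p hp).le
      _ = f p.1 + r + ((ε + ε + ε : ℝ≥0) : ℝ≥0∞) := by push_cast; ring

end Nets

/-! ### Directed sets of formal balls as nets. -/

section BallNets

variable {X : Type u} {d : X → X → ℝ≥0∞} {Y : Set (X × ℝ≥0)}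

/-- The strict order of formal balls, restricted to a set of formal balls. -/
def ballLt (d : X → X → ℝ≥0∞) (Y : Set (X × ℝ≥0)) (p q : Y) : Prop :=
  d p.1.1 q.1.1 + q.1.2 < p.1.2

theorem directedSet_ball_iff :
    DirectedSet (charFn (strict (plus d))) Y ↔ ∀ F : Set (X × ℝ≥0), F.Finite → F ⊆ Y →
      ∃ q ∈ Y, ∀ p ∈ F, d p.1 q.1 + q.2 < p.2 := by
  simp only [directedSet_charFn_iff, strict_plus_iff]

theorem isMaximum_ball_iff {q : X × ℝ≥0} :
    IsMaximum (charFn (strict (plus d))) q Y ↔ (∀ p ∈ Y, d p.1 q.1 + q.2 < p.2) ∧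
      ∀ p : X × ℝ≥0, d p.1 q.1 + q.2 < p.2 → ∃ y ∈ Y, d p.1 y.1 + y.2 < p.2 := by
  simp only [isMaximum_charFn_iff, strict_plus_iff]

theorem isNetOrder_ballLt (hd : IsDistance d)
    (hY : DirectedSet (charFn (strict (plus d))) Y) : IsNetOrder (ballLt d Y) := by
  rw [directedSet_ball_iff] at hY
  refine ⟨?_, fun p q w hpq hqw => ?_, fun p q => ?_⟩
  · obtain ⟨y, hy, -⟩ := hY ∅ Set.finite_empty (Set.empty_subset _)
    exact ⟨⟨y, hy⟩⟩
  · unfold ballLt at *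
    calc d p.1.1 w.1.1 + w.1.2 ≤ d p.1.1 q.1.1 + d q.1.1 w.1.1 + w.1.2 := by
          gcongr; exact hd.triangle _ _ _
      _ = d p.1.1 q.1.1 + (d q.1.1 w.1.1 + w.1.2) := add_assoc _ _ _
      _ ≤ d p.1.1 q.1.1 + q.1.2 := by gcongr
      _ < p.1.2 := hpq
  · obtain ⟨y, hy, h⟩ := hY {p.1, q.1} (by simp) (by
      rintro _ (rfl | rfl)
      exacts [p.2, q.2])
    exact ⟨⟨y, hy⟩, h _ (by simp), h _ (by simp)⟩

/-- The centres of a directed set of formal balls form a Cauchy net, along which the radii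
converge to their infimum. -/
theorem cauchyNet_ballLt (hd : IsDistance d)
    (hY : DirectedSet (charFn (strict (plus d))) Y) :
    CauchyNet d (ballLt d Y) (fun p => p.1.1) ∧
      ∃ r : ℝ≥0, (∀ p ∈ Y, r ≤ p.2) ∧
        Filter.Tendsto (fun p : Y => p.1.2) (tails (ballLt d Y)) (nhds r) := by
  have hΛ := isNetOrder_ballLt hd hY
  have hr : ∀ p ∈ Y, sInf (Prod.snd '' Y) ≤ p.2 := fun p hp =>
    csInf_le (OrderBot.bddBelow _) ⟨p, hp, rfl⟩
  have key : ∀ s, sInf (Prod.snd '' Y) < s → ∀ᶠ p in tails (ballLt d Y), p.1.2 < s := by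
    intro s hs
    obtain ⟨⟨y, hy⟩⟩ := hΛ.1
    obtain ⟨_, ⟨p, hp, rfl⟩, hps⟩ := exists_lt_of_csInf_lt (Set.image_nonempty.2 ⟨y, hy⟩) hs
    refine (eventually_tails_lt hΛ ⟨p, hp⟩).mono fun q hq => lt_trans ?_ hps
    exact_mod_cast le_add_self.trans_lt (show d p.1 q.1.1 + q.1.2 < p.2 from hq)
  refine ⟨ENNReal.tendsto_nhds_zero.2 fun ε hε => ?_, _, hr,
    tendsto_order.2 ⟨fun s hs => .of_forall fun p => hs.trans_le (hr _ p.2), key⟩⟩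
  obtain ⟨δ, hδ, h⟩ := ENNReal.lt_iff_exists_add_pos_lt.1 hε
  rw [zero_add] at h
  refine (key (sInf (Prod.snd '' Y) + δ) (lt_add_of_pos_right _ hδ)).mono fun p hp =>
    iSup₂_le fun q hq => le_trans ?_ h.le
  -- The distance between centres is bounded by the drop in radius, hence by the excess of `p.1.2`
  -- over the infimum.
  refine (ENNReal.add_le_add_iff_right (a := (sInf (Prod.snd '' Y) : ℝ≥0)) ENNReal.coe_ne_top).1 ?_
  calc d p.1.1 q.1.1 + (sInf (Prod.snd '' Y) : ℝ≥0)
      ≤ d p.1.1 q.1.1 + q.1.2 := by gcongr; exact hr _ q.2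
    _ ≤ p.1.2 := le_of_lt hq
    _ ≤ (sInf (Prod.snd '' Y) + δ : ℝ≥0) := by exact_mod_cast hp.le
    _ = δ + (sInf (Prod.snd '' Y) : ℝ≥0) := by rw [ENNReal.coe_add, add_comm]

end BallNets

/-! ### Completeness and continuity. -/

section Main

variable {X : Type u} {d : X → X → ℝ≥0∞}

theorem TopComplete.maxComplete (hd : IsDistance d) (h : TopComplete d (smyth d)) :
    MaxComplete (charFn (strict (plus d))) := by
  intro Y hY
  have hΛ := isNetOrder_ballLt hd hY
  have := tails_neBot hΛ
  obtain ⟨hC, r, hr, hlim⟩ := cauchyNet_ballLt hd hY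
  obtain ⟨l, hl⟩ := h _ _ hΛ _ hC
  rw [tendsto_smyth_iff] at hl
  have hsum : ∀ c, Filter.Tendsto (fun p : Y => d c p.1.1 + p.1.2) (tails (ballLt d Y))
      (nhds (d c l + r)) := fun c => (hl c).add (ENNReal.tendsto_coe.2 hlim)
  refine ⟨(l, r), isMaximum_ball_iff.2 ⟨fun p hp => ?_, fun p hp => ?_⟩⟩
  · obtain ⟨q, hpq, -⟩ := hΛ.2.2 ⟨p, hp⟩ ⟨p, hp⟩
    refine lt_of_le_of_lt (le_of_tendsto (hsum p.1)
      ((eventually_tails_lt hΛ q).mono fun w hw => ?_)) hpq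
    calc d p.1 w.1.1 + w.1.2 ≤ d p.1 q.1.1 + d q.1.1 w.1.1 + w.1.2 := by
          gcongr; exact hd.triangle _ _ _
      _ = d p.1 q.1.1 + (d q.1.1 w.1.1 + w.1.2) := add_assoc _ _ _
      _ ≤ d p.1 q.1.1 + q.1.2 := by gcongr; exact le_of_lt hw
  · obtain ⟨y, hy⟩ := ((hsum p.1).eventually_lt_const hp).exists
    exact ⟨y, y.2, hy⟩

theorem topComplete_of_maxComplete (hd : IsDistance d)
    (h : MaxComplete (charFn (strict (plus d)))) : TopComplete d (smyth d) := by
  intro Λ lt hΛ x hx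
  have := tails_neBot hΛ
  choose f hf using hx.exists_tendsto hd hΛ
  obtain ⟨⟨l, r⟩, hmax⟩ := h {p | f p.1 < p.2} (directedSet_ball_iff.2 fun F hF hFY => by
    simpa using hx.exists_ball hΛ hf 0 hF (fun p hp => by simpa using hFY hp))
  obtain ⟨h1, h2⟩ := isMaximum_ball_iff.1 hmax
  -- The two clauses of maximality, tested on balls with centre `c` and arbitrary radius, give the
  -- two inequalities.
  have hfd : ∀ c, f c = d c l + r := by
    refine fun c => le_antisymm ?_ ?_
    · refine le_of_forall_gt fun s hs => ?_
      obtain ⟨t, hst, hts⟩ := ENNReal.lt_iff_exists_nnreal_btwn.1 hs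
      obtain ⟨y, hy, hyt⟩ := h2 (c, t) hst
      refine lt_trans (lt_of_le_of_lt ?_ hyt) hts
      calc f c ≤ d c y.1 + f y.1 :=
            le_of_tendsto_of_tendsto' (hf c) ((hf y.1).const_add _) fun γ => hd.triangle _ _ _
        _ ≤ d c y.1 + y.2 := by gcongr; exact le_of_lt hy
    · refine le_of_forall_gt fun s hs => ?_
      obtain ⟨t, hst, hts⟩ := ENNReal.lt_iff_exists_nnreal_btwn.1 hs
      exact (h1 (c, t) hst).trans hts
  -- Centres `x γ` far along the net have `f (x γ)` arbitrarily small, and `r` is a summand of each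
  -- value of `f`.
  have hr : (r : ℝ≥0∞) = 0 := by
    refine le_antisymm (le_of_forall_gt fun ε hε => ?_) bot_le
    obtain ⟨δ, hδ, h⟩ := ENNReal.lt_iff_exists_add_pos_lt.1 hε
    rw [zero_add] at h
    obtain ⟨γ, hγ⟩ := (hx.eventually_le (ENNReal.coe_pos.2 hδ)).exists
    have : f (x γ) ≤ δ := le_of_tendsto (hf (x γ)) ((eventually_tails_lt hΛ γ).mono hγ)
    rw [hfd] at this
    exact (le_add_self.trans this).trans_lt h
  refine ⟨l, (tendsto_smyth_iff d).2 fun c => ?_⟩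
  simpa [hfd, hr] using hf c

theorem comp_zero_eq_zero_iff :
    comp (0 : X → X → ℝ≥0∞) d = 0 ↔ ∀ y, ∀ ε : ℝ≥0, 0 < ε → ∃ z, d z y < ε := by
  constructor
  · intro h y ε hε
    have h0 : (⨅ z, (0 : X → X → ℝ≥0∞) y z + d z y) = 0 := congrFun (congrFun h y) y
    have : (⨅ z, (0 : X → X → ℝ≥0∞) y z + d z y) < ε := h0 ▸ ENNReal.coe_pos.2 hε
    simpa [iInf_lt_iff] using this
  · intro h
    ext x y
    refine le_antisymm (le_of_forall_gt fun ε hε => ?_) bot_le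
    obtain ⟨δ, hδ, hδε⟩ := ENNReal.lt_iff_exists_add_pos_lt.1 hε
    obtain ⟨z, hz⟩ := h y δ hδ
    refine lt_of_le_of_lt (iInf_le _ z) ?_
    simpa using hz.trans (by simpa using hδε)

/-- The directed set consists of all balls strictly below `(l, r)`; `CauchyNet.exists_ball` for a
singleton is the interpolation needed for maximality. -/
theorem TopContinuous.maxContinuous (h : TopContinuous d (smyth d)) :
    MaxContinuous (charFn (strict (plus d))) := by
  rintro ⟨l, r⟩
  obtain ⟨Λ, lt, x, hΛ, hx, hl⟩ := h l
  rw [tendsto_smyth_iff] at hl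
  refine ⟨{p | d p.1 l + r < p.2},
    directedSet_ball_iff.2 fun F hF hFY => hx.exists_ball hΛ hl r hF hFY,
    isMaximum_ball_iff.2 ⟨fun p hp => hp, fun p hp => ?_⟩⟩
  obtain ⟨q, hq, hpq⟩ := hx.exists_ball hΛ hl r (Set.finite_singleton p) (by simpa using hp)
  exact ⟨q, hq, hpq p rfl⟩

theorem TopContinuous.comp_zero (h : TopContinuous d (smyth d)) :
    comp (0 : X → X → ℝ≥0∞) d = 0 := by
  refine comp_zero_eq_zero_iff.2 fun l ε hε => ?_
  obtain ⟨Λ, lt, x, hΛ, hx, hl⟩ := h l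
  rw [tendsto_smyth_iff] at hl
  have := tails_neBot hΛ
  have hε2 : (0 : ℝ≥0∞) < (ε / 2 : ℝ≥0) := ENNReal.coe_pos.2 (half_pos hε)
  obtain ⟨γ, hγ⟩ := (hx.eventually_le hε2).exists
  refine ⟨x γ, (le_of_tendsto (hl (x γ)) ((eventually_tails_lt hΛ γ).mono hγ)).trans_lt ?_⟩
  exact_mod_cast NNReal.half_lt_self hε.ne'

theorem topContinuous_of_maxContinuous (hd : IsDistance d)
    (h : MaxContinuous (charFn (strict (plus d)))) (h0 : comp (0 : X → X → ℝ≥0∞) d = 0) :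
    TopContinuous d (smyth d) := by
  intro l
  obtain ⟨Y, hY, hmax⟩ := h (l, 0)
  have hΛ := isNetOrder_ballLt hd hY
  obtain ⟨hC, r, hr, hlim⟩ := cauchyNet_ballLt hd hY
  simp only [isMaximum_ball_iff, ENNReal.coe_zero, add_zero] at hmax
  obtain ⟨h1, h2⟩ := hmax
  -- If `r > 0`, some `(z, r)` lies strictly below `(l, 0)`, hence below a ball of `Y`, whose radius
  -- is then less than the infimum `r`.
  have hr0 : r = 0 := by
    by_contra hne
    obtain ⟨z, hz⟩ := comp_zero_eq_zero_iff.1 h0 l r (pos_iff_ne_zero.2 hne)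
    obtain ⟨y, hy, hyr⟩ := h2 (z, r) hz
    exact (hr y hy).not_gt (by exact_mod_cast le_add_self.trans_lt hyr)
  subst hr0
  refine ⟨Y, ballLt d Y, fun p => p.1.1, hΛ, hC, (tendsto_smyth_iff d).2 fun c =>
    tendsto_order.2 ⟨fun s hs => ?_, fun s hs => ?_⟩⟩
  -- The lower bound holds because `d p.1.1 l` is less than the radius of `p`, which tends to `0`.
  · obtain ⟨ε, hε, hsε⟩ := ENNReal.lt_iff_exists_add_pos_lt.1 hs
    refine (hlim.eventually_lt_const hε).mono fun p hp => ?_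
    by_contra! hle
    refine hsε.not_ge ((hd.triangle c l p.1.1).trans (add_le_add hle ((h1 _ p.2).le.trans ?_)))
    exact_mod_cast hp.le
  · obtain ⟨t, hst, hts⟩ := ENNReal.lt_iff_exists_nnreal_btwn.1 hs
    obtain ⟨y, hy, hyt⟩ := h2 (c, t) hst
    refine (eventually_tails_lt hΛ ⟨y, hy⟩).mono fun p hp => ?_
    calc d c p.1.1 ≤ d c y.1 + d y.1 p.1.1 := hd.triangle _ _ _
      _ ≤ d c y.1 + y.2 := by gcongr; exact le_self_add.trans (le_of_lt hp)
      _ < t := hyt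
      _ < s := hts

end Main

end DistDom

theorem mainTheorem10 {X : Type u} (d : X → X → ℝ≥0∞) (hd : DistDom.IsDistance d) :
    (DistDom.lower (DistDom.plus d) = DistDom.plus (DistDom.lower d) →
      (DistDom.TopComplete d (DistDom.smyth d) ↔
        DistDom.MaxComplete (DistDom.charFn (DistDom.strict (DistDom.plus d))))) ∧
    (DistDom.TopContinuous d (DistDom.smyth d) ↔
      DistDom.MaxContinuous (DistDom.charFn (DistDom.strict (DistDom.plus d))) ∧
        DistDom.comp (0 : X → X → ℝ≥0∞) d = 0) :=
  ⟨fun _ => ⟨fun h => h.maxComplete hd, DistDom.topComplete_of_maxComplete hd⟩,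
    fun h => ⟨h.maxContinuous, h.comp_zero⟩,
    fun h => DistDom.topContinuous_of_maxContinuous hd h.1 h.2⟩
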